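/- Let $\mathfrak g$ be a finite-dimensional real Lie algebra that is solvable and unimodular ($\operatorname{tr}\operatorname{ad}_x=0$ for all $x$), and let $(J,\langle\cdot,\cdot\rangle)$ be a Vaisman structure on $\mathfrak g$ with Lee form $\theta$. That is: $J^2=-\mathrm{Id}$ and $[Jx,Jy]-[x,y]-J([Jx,y]+[x,Jy])=0$; $\langle\cdot,\cdot\rangle$ is an inner product with $\langle Jx,Jy\rangle=\langle x,y\rangle$; with $\omega(x,y)=\langle Jx,y\rangle$ one has $d\theta=0$ and $d\omega=\theta\wedge\omega$; and $\nabla\theta=0$ for the Levi-Civita connection $\nabla$. Let $A\in\mathfrak g$ be the metric dual of $\theta$, and assume the metric is normalized so that $|A|=1$. Let $\mathfrak k=\operatorname{span}\{A,JA\}^{\perp}$, with the bracket $[x,y]_{\mathfrak k}$ defined as the orthogonal projection of $[x,y]$ to $\mathfrak k$, and let $D'x=[A,x]$ for $x\in\mathfrak k$. Then $(\mathfrak k,[\cdot,\cdot]_{\mathfrak k})$ is a Lie algebra, $D'$ maps $\mathfrak k$ to $\mathfrak k$ and is a derivation of it, and the semidirect product $\mathfrak d=\mathbb RA\ltimes_{D'}\mathfrak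 k$, with bracket $[aA+x,bA+y]_{\mathfrak d}=aD'y-bD'x+[x,y]_{\mathfrak k}$, has the coKähler structure $(\langle\cdot,\cdot\rangle|_{\mathfrak d\times\mathfrak d},\phi,\xi,\eta)$ given by $$\phi(aA+x)=Jx\quad(a\in\mathbb R,\ x\in\mathfrak k),\qquad \xi=A,\qquad \eta=\theta|_{\mathfrak d}.$$ Here coKähler means: $\eta(\xi)=1$; $\phi^2=-\mathrm{Id}+\eta\otimes\xi$; $\langle\phi u,\phi v\rangle=\langle u,v\rangle-\eta(u)\eta(v)$; $d\eta=0$; $d\Phi=0$, where $\Phi(u,v)=\langle\phi u,v\rangle$; and $[\phi u,\phi v]+\phi^2[u,v]-\phi([\phi u,v]+[u,\phi v])=-d\eta(u,v)\,\xi$, all brackets and differentials being those of $\mathfrak d$. Moreover, $\mathfrak g$ is isomorphic to the central extension $\mathfrak d_\Phi(JA)=\mathfrak d\oplus\mathbb R\,JA$ of $\mathfrak d$ by the closed form $\Phi$, in which $JA$ is central and $[u,v]_\Phi=[u,v]_{\mathfrak d}+\Phi(u,v)\,JA$ for $u,v\in\mathfrak d$; the map $u+tJA\mapsto u+tJA\in\mathfrak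 g$ ($u\in\mathfrak d$, $t\in\mathbb R$) is an isomorphism of Lie algebras. -/

import Mathlib

/-! ### Lie algebras: unimodularity, forms and the Chevalley–Eilenberg differential -/

/-- A Lie algebra is unimodular if every `ad x` has trace zero. -/
def IsUnimodularLie (g : Type*) [LieRing g] [LieAlgebra ℝ g] : Prop :=
  ∀ x : g, LinearMap.trace ℝ g (LieAlgebra.ad ℝ g x) = 0

/-- The differential `dθ` of a 1-form (trivial coefficients). -/
def extDerivOne {g : Type*} [LieRing g] [LieAlgebra ℝ g] (θ : Module.Dual ℝ g) (x y : g) : ℝ :=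
  -θ ⁅x, y⁆

/-- The differential `dω` of a 2-form (trivial coefficients). -/
def extDerivTwo {g : Type*} [LieRing g] [LieAlgebra ℝ g] (ω : LinearMap.BilinForm ℝ g)
    (x y z : g) : ℝ :=
  -ω ⁅x, y⁆ z - ω ⁅y, z⁆ x - ω ⁅z, x⁆ y

/-- The wedge product `θ ∧ ω` of a 1-form and a 2-form. -/
def wedgeOneTwo {g : Type*} [AddCommGroup g] [Module ℝ g] (θ : Module.Dual ℝ g)
    (ω : LinearMap.BilinForm ℝ g) (x y z : g) : ℝ :=
  θ x * ω y z + θ y * ω z x + θ z * ω x y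

/-- The bilinear form `(x, y) ↦ ⟨f x, y⟩`. -/
def fundamentalForm {g : Type*} [AddCommGroup g] [Module ℝ g] (m : LinearMap.BilinForm ℝ g)
    (f : g →ₗ[ℝ] g) : LinearMap.BilinForm ℝ g :=
  m.comp f LinearMap.id

@[simp] lemma fundamentalForm_apply {g : Type*} [AddCommGroup g] [Module ℝ g]
    (m : LinearMap.BilinForm ℝ g) (f : g →ₗ[ℝ] g) (x y : g) :
    fundamentalForm m f x y = m (f x) y := rfl

/-- `m` is a (positive definite) inner product. -/
structure IsInnerProductForm {g : Type*} [AddCommGroup g] [Module ℝ g]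
    (m : LinearMap.BilinForm ℝ g) : Prop where
  symm : ∀ x y, m x y = m y x
  pos : ∀ x, x ≠ 0 → 0 < m x x

/-! ### Central extensions by a closed 2-form -/

/-- An alternating 2-form, as a 2-cochain with values in the trivial module `ℝ`. -/
def altFormCochain {h : Type*} [LieRing h] [LieAlgebra ℝ h] (β : LinearMap.BilinForm ℝ h)
    (halt : β.IsAlt) : LieModule.Cohomology.twoCochain ℝ h (TrivialLieModule ℝ h ℝ) where
  val := β.compr₂ (TrivialLieModule.equiv ℝ h ℝ).symm.toLinearMap
  property := fun x => halt.self_eq_zero x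

lemma altFormCochain_d {h : Type*} [LieRing h] [LieAlgebra ℝ h] (β : LinearMap.BilinForm ℝ h)
    (halt : β.IsAlt) (x y z : h) :
    LieModule.Cohomology.d₂₃ ℝ h (TrivialLieModule ℝ h ℝ) (altFormCochain β halt) x y z
      = (TrivialLieModule.equiv ℝ h ℝ).symm (extDerivTwo β x y z) := by
  have h2 : β ⁅x, z⁆ y = -β ⁅z, x⁆ y := by
    rw [← lie_skew x z, map_neg, LinearMap.neg_apply]
  change (0 : ℝ) - 0 + 0 - β ⁅x, y⁆ z + β ⁅x, z⁆ y - β ⁅y, z⁆ x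
    = -β ⁅x, y⁆ z - β ⁅y, z⁆ x - β ⁅z, x⁆ y
  rw [h2]; ring

/-- An alternating closed 2-form, as a 2-cocycle with values in the trivial module `ℝ`. -/
def closedFormCocycle {h : Type*} [LieRing h] [LieAlgebra ℝ h] (β : LinearMap.BilinForm ℝ h)
    (halt : β.IsAlt) (hclosed : ∀ x y z, extDerivTwo β x y z = 0) :
    LieModule.Cohomology.twoCocycle ℝ h (TrivialLieModule ℝ h ℝ) :=
  ⟨altFormCochain β halt, by
    rw [LieModule.Cohomology.mem_twoCocycle_iff]
    refine LinearMap.ext fun x => LinearMap.ext fun y => LinearMap.ext fun z => ?_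
    exact (altFormCochain_d β halt x y z).trans (by rw [hclosed, map_zero]; rfl)⟩

/-- The central extension `h_β(ξ)` of `h` by the closed 2-form `β`: the vector space `h × ℝ`, where
`(0, 1) = ξ`, with the bracket `[x + sξ, y + tξ] = [x, y] + β(x, y) ξ`. -/
abbrev CentralExtension {h : Type*} [LieRing h] [LieAlgebra ℝ h] (β : LinearMap.BilinForm ℝ h)
    (halt : β.IsAlt) (hclosed : ∀ x y z, extDerivTwo β x y z = 0) : Type _ :=
  LieAlgebra.ofTwoCocycle (closedFormCocycle β halt hclosed)

/-- The element `x + tξ` of the central extension. -/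
def CentralExtension.mk {h : Type*} [LieRing h] [LieAlgebra ℝ h] {β : LinearMap.BilinForm ℝ h}
    {halt : β.IsAlt} {hclosed : ∀ x y z, extDerivTwo β x y z = 0} (x : h) (t : ℝ) :
    CentralExtension β halt hclosed :=
  ⟨(x, (TrivialLieModule.equiv ℝ h ℝ).symm t)⟩

lemma CentralExtension.mk_lie_mk {h : Type*} [LieRing h] [LieAlgebra ℝ h]
    {β : LinearMap.BilinForm ℝ h} {halt : β.IsAlt}
    {hclosed : ∀ x y z, extDerivTwo β x y z = 0} (x y : h) (s t : ℝ) :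
    ⁅(mk x s : CentralExtension β halt hclosed), (mk y t : CentralExtension β halt hclosed)⁆
      = mk ⁅x, y⁆ (β x y) := by
  rw [LieAlgebra.bracket_ofTwoCocycle]
  simp only [trivial_lie_zero, add_zero, sub_zero]
  rfl

/- The additive group `ℝ` carries the commutator bracket, that is, the zero bracket. -/
attribute [local instance] LieRing.ofAssociativeRing

/-! ### Semidirect products `ℝ ⋉_D k` -/

/-- The one-parameter family `t ↦ t D` of derivations, as a Lie algebra morphism from `ℝ`. -/
def derivationAction {k : Type*} [LieRing k] [LieAlgebra ℝ k] (D : LieDerivation ℝ k k) :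
    ℝ →ₗ⁅ℝ⁆ LieDerivation ℝ k k where
  toLinearMap := LinearMap.toSpanSingleton ℝ _ D
  map_lie' := by
    intro s t
    have : ⁅s, t⁆ = (0 : ℝ) := by rw [Ring.lie_def, mul_comm, sub_self]
    simp [this]

/-- The semidirect product `ℝ ⋉_D k`; its elements are pairs `⟨x, a⟩` with `x : k`, `a : ℝ`, and
`[⟨x, a⟩, ⟨y, b⟩] = ⟨[x, y] + a D y - b D x, 0⟩`. -/
abbrev RealSemidirect {k : Type*} [LieRing k] [LieAlgebra ℝ k] (D : LieDerivation ℝ k k) : Type _ :=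
  LieAlgebra.SemiDirectSum k ℝ (derivationAction D)

lemma RealSemidirect.lie_eq {k : Type*} [LieRing k] [LieAlgebra ℝ k] (D : LieDerivation ℝ k k)
    (x y : k) (a b : ℝ) :
    ⁅(⟨x, a⟩ : RealSemidirect D), (⟨y, b⟩ : RealSemidirect D)⁆
      = ⟨⁅x, y⁆ + a • D y - b • D x, 0⟩ := by
  rw [LieAlgebra.SemiDirectSum.lie_eq_mk, Ring.lie_def, mul_comm, sub_self]
  rfl

/-! ### Almost contact metric and coKähler structures -/

/-- Almost contact metric structures `(⟨·,·⟩, φ, ξ, η)`. -/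
structure IsAlmostContactMetric {h : Type*} [AddCommGroup h] [Module ℝ h]
    (m : LinearMap.BilinForm ℝ h) (φ : h →ₗ[ℝ] h) (ξ : h) (η : Module.Dual ℝ h) : Prop where
  inner : IsInnerProductForm m
  eta_xi : η ξ = 1
  phi_sq : ∀ x, φ (φ x) = -x + η x • ξ
  compat : ∀ x y, m (φ x) (φ y) = m x y - η x * η y

/-- The Nijenhuis tensor `N_φ(x, y) = [φx, φy] + φ²[x, y] - φ([φx, y] + [x, φy])`. -/
def nijenhuis {h : Type*} [LieRing h] [LieAlgebra ℝ h] (φ : h →ₗ[ℝ] h) (x y : h) : h :=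
  ⁅φ x, φ y⁆ + φ (φ ⁅x, y⁆) - φ (⁅φ x, y⁆ + ⁅x, φ y⁆)

/-- CoKähler structures: normal almost contact metric structures with `dη = dΦ = 0`, where
`Φ = fundamentalForm m φ`. -/
structure IsCoKahler {h : Type*} [LieRing h] [LieAlgebra ℝ h]
    (m : LinearMap.BilinForm ℝ h) (φ : h →ₗ[ℝ] h) (ξ : h) (η : Module.Dual ℝ h) : Prop
    extends IsAlmostContactMetric m φ ξ η where
  eta_closed : ∀ x y, extDerivOne η x y = 0
  Phi_closed : ∀ x y z, extDerivTwo (fundamentalForm m φ) x y z = 0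
  normal : ∀ x y, nijenhuis φ x y = -(extDerivOne η x y • ξ)

/-- The fundamental 2-form of an almost contact metric structure is alternating. -/
lemma IsAlmostContactMetric.isAlt {h : Type*} [AddCommGroup h] [Module ℝ h]
    {m : LinearMap.BilinForm ℝ h} {φ : h →ₗ[ℝ] h} {ξ : h} {η : Module.Dual ℝ h}
    (H : IsAlmostContactMetric m φ ξ η) : (fundamentalForm m φ).IsAlt := by
  have hφξ : φ ξ = 0 := by
    by_contra hne
    have h0 := H.compat ξ ξ
    have h1 : φ (φ ξ) = 0 := by rw [H.phi_sq, H.eta_xi]; simp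
    have h2 := H.compat (φ ξ) (φ ξ)
    have h3 : φ (φ (φ ξ)) = -(φ ξ) + η (φ ξ) • ξ := H.phi_sq _
    rw [h1] at h3 h2
    simp only [map_zero] at h3 h2
    have h4 : φ ξ = η (φ ξ) • ξ := by
      have := congrArg (fun v => φ ξ + v) h3
      simpa using this
    have h5 : η (φ ξ) = 0 := by
      have h6 : η (φ ξ) • φ ξ = 0 := by
        have := congrArg φ h4
        rw [h1, map_smul] at this
        exact this.symm
      rcases smul_eq_zero.1 h6 with h7 | h7
      · exact h7
      · exact absurd h7 hne
    rw [h5, zero_smul] at h4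
    exact hne h4
  intro x
  change m (φ x) x = 0
  have hηφ : η (φ x) = 0 := by
    have a : φ (φ (φ x)) = -(φ x) + η (φ x) • ξ := H.phi_sq _
    rw [H.phi_sq x, map_add, map_neg, map_smul, hφξ, smul_zero, add_zero] at a
    have b : η (φ x) • ξ = 0 := by simpa using a.symm
    have c := congrArg η b
    simpa [H.eta_xi] using c
  have e1 := H.compat (φ x) x
  have e2 := H.inner.symm (φ x) x
  have e3 : m ξ (φ x) = 0 := by
    have := H.compat ξ (φ x)
    rw [hφξ, hηφ] at this
    simpa using this.symm
  rw [H.phi_sq x, hηφ] at e1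
  simp only [map_add, map_neg, map_smul, LinearMap.add_apply, LinearMap.neg_apply,
    LinearMap.smul_apply, e3, smul_eq_mul] at e1
  linarith

/-! ### LCK and Vaisman structures -/

/-- `∇` is the Levi-Civita connection of the left invariant metric `m`: torsion free and metric. -/
structure IsLeviCivita {g : Type*} [LieRing g] [LieAlgebra ℝ g] (m : LinearMap.BilinForm ℝ g)
    (nabla : g →ₗ[ℝ] g →ₗ[ℝ] g) : Prop where
  torsion_free : ∀ x y, nabla x y - nabla y x = ⁅x, y⁆
  metric : ∀ x y z, m (nabla x y) z + m y (nabla x z) = 0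

/-- A Hermitian structure: an integrable complex structure `J` (that is, `J² = -Id` and `N_J = 0`)
and a compatible inner product. -/
structure HermitianLie (g : Type*) [LieRing g] [LieAlgebra ℝ g] where
  J : g →ₗ[ℝ] g
  metric : LinearMap.BilinForm ℝ g
  J_sq : ∀ x, J (J x) = -x
  integrable : ∀ x y, ⁅J x, J y⁆ - ⁅x, y⁆ - J (⁅J x, y⁆ + ⁅x, J y⁆) = 0
  inner : IsInnerProductForm metric
  compat : ∀ x y, metric (J x) (J y) = metric x y

/-- The fundamental 2-form `ω(x, y) = ⟨J x, y⟩`. -/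
def HermitianLie.omega {g : Type*} [LieRing g] [LieAlgebra ℝ g] (H : HermitianLie g) :
    LinearMap.BilinForm ℝ g :=
  fundamentalForm H.metric H.J

/-- An LCK structure with its Lee form `θ`. -/
structure LCKLie (g : Type*) [LieRing g] [LieAlgebra ℝ g] extends HermitianLie g where
  theta : Module.Dual ℝ g
  theta_closed : ∀ x y, extDerivOne theta x y = 0
  d_omega : ∀ x y z, extDerivTwo toHermitianLie.omega x y z
    = wedgeOneTwo theta toHermitianLie.omega x y z

/-- A Vaisman structure: the Lee form is parallel for the Levi-Civita connection, that is,
`(∇_x θ)(y) = -θ(∇_x y)` vanishes. -/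
structure VaismanLie (g : Type*) [LieRing g] [LieAlgebra ℝ g] extends LCKLie g where
  parallel : ∃ nabla : g →ₗ[ℝ] g →ₗ[ℝ] g, IsLeviCivita metric nabla ∧
    ∀ x y, theta (nabla x y) = 0

/-- A Vaisman structure whose metric is normalized so that the metric dual `A` of the Lee form is a
unit vector. -/
structure UnitVaismanLie (g : Type*) [LieRing g] [LieAlgebra ℝ g] extends VaismanLie g where
  A : g
  dual : ∀ x, theta x = metric A x
  unit : metric A A = 1

namespace UnitVaismanLie

variable {g : Type*} [LieRing g] [LieAlgebra ℝ g] (V : UnitVaismanLie g)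

/-- The orthogonal complement `W` of `span {A, JA}`. -/
def W : Submodule ℝ g := V.metric.orthogonal (Submodule.span ℝ {V.A, V.J V.A})

lemma mem_W {x : g} : x ∈ V.W ↔ V.metric V.A x = 0 ∧ V.metric (V.J V.A) x = 0 := by
  constructor
  · intro h
    exact ⟨h _ (Submodule.subset_span (by simp)), h _ (Submodule.subset_span (by simp))⟩
  · rintro ⟨h1, h2⟩ n hn
    obtain ⟨a, b, rfl⟩ := Submodule.mem_span_pair.1 hn
    simp [h1, h2]

lemma metric_A_JA : V.metric V.A (V.J V.A) = 0 := by
  have h1 := V.compat V.A (V.J V.A)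
  rw [V.J_sq, map_neg, V.inner.symm] at h1
  linarith

lemma metric_JA_A : V.metric (V.J V.A) V.A = 0 := by
  rw [V.inner.symm]; exact V.metric_A_JA

lemma metric_JA_JA : V.metric (V.J V.A) (V.J V.A) = 1 := by rw [V.compat, V.unit]

lemma J_mem_W {x : g} (hx : x ∈ V.W) : V.J x ∈ V.W := by
  rw [mem_W] at hx ⊢
  have h1 := V.compat V.A (V.J x)
  have h2 := V.compat V.A x
  rw [V.J_sq, map_neg] at h1
  exact ⟨by linarith [hx.2], by linarith [hx.1]⟩

/-- The orthogonal projection of `g` onto `W`. -/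
def projW : g →ₗ[ℝ] V.W :=
  LinearMap.codRestrict V.W
    (LinearMap.id - (V.metric V.A).smulRight V.A - (V.metric (V.J V.A)).smulRight (V.J V.A))
    (fun x => by
      rw [mem_W]
      constructor <;>
        simp [V.unit, V.metric_A_JA, V.metric_JA_A, V.metric_JA_JA])

lemma projW_coe (x : g) :
    (V.projW x : g) = x - V.metric V.A x • V.A - V.metric (V.J V.A) x • V.J V.A := rfl

/-- The bracket `[x, y]_W` on `W`: the component in `W` of the bracket of `g`. -/
def bracketW (x y : V.W) : V.W := V.projW ⁅(x : g), (y : g)⁆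

/-- The Jacobi identity (in Leibniz form) for the bracket `[·,·]_W`. -/
def JacobiW : Prop :=
  ∀ x y z : V.W, V.bracketW x (V.bracketW y z)
    = V.bracketW (V.bracketW x y) z + V.bracketW y (V.bracketW x z)

/-- The Lie algebra `k = (W, [·,·]_W)`; the Jacobi identity is an argument. -/
@[nolint unusedArguments]
def K (_hk : V.JacobiW) : Type _ := V.W

variable {V} (hk : V.JacobiW)

instance : AddCommGroup (V.K hk) := inferInstanceAs (AddCommGroup V.W)

instance : Module ℝ (V.K hk) := inferInstanceAs (Module ℝ V.W)

instance : LieRing (V.K hk) where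
  bracket x y := V.bracketW x y
  add_lie x y z := by
    change V.projW ⁅V.W.subtype x + V.W.subtype y, _⁆ = _
    rw [add_lie, map_add]; rfl
  lie_add x y z := by
    change V.projW ⁅_, V.W.subtype y + V.W.subtype z⁆ = _
    rw [lie_add, map_add]; rfl
  lie_self x := by
    change V.projW ⁅_, _⁆ = _
    rw [lie_self, map_zero]; rfl
  leibniz_lie x y z := hk x y z

instance : LieAlgebra ℝ (V.K hk) where
  lie_smul t x y := by
    change V.projW ⁅_, t • V.W.subtype y⁆ = _
    rw [lie_smul, map_smul]; rfl

/-- The inclusion of the vector space `k = W` into `g` (not a Lie algebra morphism in general). -/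
def inclK : V.K hk →ₗ[ℝ] g := V.W.subtype

/-- The restriction of `J` to `k`. -/
def JK : V.K hk →ₗ[ℝ] V.K hk := V.J.restrict (p := V.W) (q := V.W) (fun _ hx => V.J_mem_W hx)

@[simp] lemma inclK_JK (x : V.K hk) : inclK hk (JK hk x) = V.J (inclK hk x) := rfl

lemma inclK_lie (x y : V.K hk) :
    inclK hk ⁅x, y⁆ = (V.projW ⁅inclK hk x, inclK hk y⁆ : g) := rfl

variable {hk} (D : LieDerivation ℝ (V.K hk) (V.K hk))

/-- The inclusion of the vector space `d = ℝA ⊕ k` into `g`, `⟨x, a⟩ ↦ aA + x`. -/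
def inclD : RealSemidirect D →ₗ[ℝ] g where
  toFun u := u.right • V.A + inclK hk u.left
  map_add' u v := by simp [add_smul]; abel
  map_smul' t u := by simp [mul_smul]

/-- The restriction of the inner product of `g` to `d`. -/
def metricD : LinearMap.BilinForm ℝ (RealSemidirect D) := V.metric.comp (inclD D) (inclD D)

/-- The endomorphism `φ(aA + x) = J x` of `d`. -/
def phiD : RealSemidirect D →ₗ[ℝ] RealSemidirect D where
  toFun u := ⟨JK hk u.left, 0⟩
  map_add' u v := by simp
  map_smul' t u := by simp

/-- The vector `ξ = A` of `d`. -/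
def xiD : RealSemidirect D := ⟨0, 1⟩

/-- The 1-form `η = θ|_d`. -/
def etaD : Module.Dual ℝ (RealSemidirect D) := V.theta.comp (inclD D)

/-- The fundamental 2-form `Φ(u, v) = ⟨φ u, v⟩` of `d`. -/
def PhiD : LinearMap.BilinForm ℝ (RealSemidirect D) := fundamentalForm (metricD D) (phiD D)

end UnitVaismanLie

/-! ### The derived algebra of a solvable Lie algebra acts nilpotently -/

/-! The whole statement rests on `JA` being central (`lie_JA`). Granting this, commutators are
orthogonal to `A` because `θ` is closed, so the bracket of two elements of `d` splits into an `A^⊥ ∩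
(JA)^⊥` part and a multiple of `JA`. Dropping the multiple amounts to passing to the quotient of `g`
by the central line `ℝ JA`, which is `d`; the dropped coefficient is exactly `Φ`, so `Φ` is the
cocycle of this extension and its closedness is the Jacobi identity of `g`.

Geometry gives that `ad A` and `ad JA` are skew and commute with `J`, that `[A, JA] = 0`, and that
`⟨JA, [x, y]⟩ = ⟨JPx, y⟩` with `P` the projection onto `W` (`metric_J_projEnd`). For centrality
there are two cases. If `JA` lies in `[g, g]`, solvability makes `ad JA` nilpotent, and a skew
nilpotent map is zero. Otherwise the functional `⟨JA, ·⟩` on `[g, g]` extends to a functional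
killing `JA`; this yields a `v` with `2 tr ad v = tr P` (`trace_ad_eq`). Unimodularity then forces
`P = 0`, so `g` is spanned by the commuting vectors `A`, `JA`. -/

open LieModule in
theorem LieModule.isNilpotent_toEnd_of_mem_derivedSeries_one_of_isAlgClosed {k L : Type*} [Field k]
    [CharZero k] [IsAlgClosed k] [LieRing L] [LieAlgebra k L] [LieAlgebra.IsSolvable L]
    {x : L} (hx : x ∈ LieAlgebra.derivedSeries k L 1) (n : ℕ) :
    ∀ (M : Type*) [AddCommGroup M] [Module k M] [LieRingModule L M] [LieModule k L M]
      [FiniteDimensional k M], Module.finrank k M = n → _root_.IsNilpotent (toEnd k L M x) := by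
  induction n using Nat.strong_induction_on with
  | _ n ih =>
  intro M _ _ _ _ _ hn
  rcases subsingleton_or_nontrivial M with hM | hM
  · exact ⟨1, LinearMap.ext fun _ => Subsingleton.elim _ _⟩
  -- Lie's theorem: a common eigenspace `N` exists. Its weight is a character, hence zero on `[L,
  -- L]`, so `x` kills `N`; induction on the dimension handles `M ⧸ N`, and one more power finishes.
  obtain ⟨χ, hχ⟩ := exists_nontrivial_weightSpace_of_isSolvable k L M
  obtain ⟨⟨v, hv⟩, hv0⟩ := exists_ne (0 : weightSpace M χ)
  have hv0 : v ≠ 0 := fun h => hv0 (Subtype.ext h)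
  have hvw := (mem_weightSpace χ v).1 hv
  let ψ : LieAlgebra.LieCharacter k L :=
    { χ with
      map_lie' := by
        intro a b
        have h1 : χ ⁅a, b⁆ • v = 0 := by
          rw [← hvw, lie_lie, hvw b, hvw a, lie_smul, lie_smul, hvw, hvw, smul_comm, sub_self]
        have h2 : χ ⁅a, b⁆ = 0 := (smul_eq_zero.1 h1).resolve_right hv0
        rw [Ring.lie_def, mul_comm, sub_self]
        exact h2 }
  have hχx : χ x = 0 := LieAlgebra.lieCharacter_apply_of_mem_derived ψ hx
  let N := weightSpace M χ
  have hlt : Module.finrank k (M ⧸ N) < n := by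
    have h1 := N.toSubmodule.finrank_quotient_add_finrank
    have h2 : 0 < Module.finrank k N := Module.finrank_pos
    change Module.finrank k (M ⧸ N) + Module.finrank k N = _ at h1
    omega
  obtain ⟨m, hm⟩ := ih _ hlt (M ⧸ N) rfl
  have hpow (w : M) (j : ℕ) : (toEnd k L (M ⧸ N) x ^ j) (LieSubmodule.Quotient.mk' N w)
      = LieSubmodule.Quotient.mk' N ((toEnd k L M x ^ j) w) := by
    induction j with
    | zero => rfl
    | succ j ihj => rw [pow_succ', pow_succ', Module.End.mul_apply, ihj]; rfl
  refine ⟨m + 1, LinearMap.ext fun w => ?_⟩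
  have h := hpow w m
  rw [hm, LinearMap.zero_apply, eq_comm, LieSubmodule.Quotient.mk_eq_zero] at h
  rw [pow_succ', Module.End.mul_apply, toEnd_apply_apply, (mem_weightSpace χ _).1 h, hχx, zero_smul,
    LinearMap.zero_apply]

open LieModule TensorProduct in
/-- If `L` is a solvable Lie algebra in characteristic zero, then `[L, L]` acts nilpotently on every
finite-dimensional representation of `L`. -/
theorem LieModule.isNilpotent_toEnd_of_mem_derivedSeries_one {k L M : Type*} [Field k]
    [CharZero k] [LieRing L] [LieAlgebra k L] [LieAlgebra.IsSolvable L]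
    [AddCommGroup M] [Module k M] [LieRingModule L M] [LieModule k L M] [FiniteDimensional k M]
    {x : L} (hx : x ∈ LieAlgebra.derivedSeries k L 1) : _root_.IsNilpotent (toEnd k L M x) := by
  let A := AlgebraicClosure k
  have hx' : 1 ⊗ₜ[k] x ∈ LieAlgebra.derivedSeries A (A ⊗[k] L) 1 := by
    rw [LieAlgebra.derivedSeries_baseChange]
    exact Submodule.tmul_mem_baseChange_of_mem 1 hx
  have h := isNilpotent_toEnd_of_mem_derivedSeries_one_of_isAlgClosed hx' _ (A ⊗[k] M) rfl
  have hinj : Function.Injective (Module.End.baseChangeHom k A M) :=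
    LinearMap.baseChangeHom_injective k M A
  rw [← IsNilpotent.map_iff hinj]
  rwa [toEnd_baseChange] at h

/-! ### Covariant derivative of the complex structure -/

namespace HermitianLie

variable {g : Type*} [LieRing g] [LieAlgebra ℝ g] (H : HermitianLie g)

lemma metric_J_left (x y : g) : H.metric (H.J x) y = -H.metric x (H.J y) := by
  have h := H.compat x (H.J y)
  rw [H.J_sq, map_neg] at h
  linarith

lemma omega_apply (x y : g) : H.omega x y = H.metric (H.J x) y := rfl

lemma eq_of_metric {x y : g} (h : ∀ z, H.metric x z = H.metric y z) : x = y := by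
  by_contra hne
  have := H.inner.pos (x - y) (sub_ne_zero.2 hne)
  rw [map_sub H.metric, LinearMap.sub_apply, h, sub_self] at this
  exact this.false

/-- The tensor `⟨(∇_x J) y, z⟩`. -/
def covDerivJ (nabla : g →ₗ[ℝ] g →ₗ[ℝ] g) (x y z : g) : ℝ :=
  H.metric (nabla x (H.J y)) z - H.metric (H.J (nabla x y)) z

section

variable {H} {nabla : g →ₗ[ℝ] g →ₗ[ℝ] g}

lemma covDerivJ_swap (hn : IsLeviCivita H.metric nabla) (x y z : g) :
    H.covDerivJ nabla x z y = -H.covDerivJ nabla x y z := by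
  have h1 := hn.metric x (H.J y) z
  have h2 := hn.metric x (H.J z) y
  have h3 := H.inner.symm (H.J y) (nabla x z)
  have h4 := H.inner.symm (H.J z) (nabla x y)
  have h5 := H.metric_J_left (nabla x y) z
  have h6 := H.metric_J_left (nabla x z) y
  unfold covDerivJ
  linarith

lemma covDerivJ_J_left (x y z : g) :
    H.covDerivJ nabla x (H.J y) z = H.covDerivJ nabla x y (H.J z) := by
  have h1 := H.metric_J_left (nabla x (H.J y)) z
  have h2 := H.compat (nabla x y) z
  unfold covDerivJ
  rw [H.J_sq, map_neg, map_neg, LinearMap.neg_apply]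
  linarith

lemma covDerivJ_J_J (x y z : g) :
    H.covDerivJ nabla x (H.J y) (H.J z) = -H.covDerivJ nabla x y z := by
  rw [covDerivJ_J_left, H.J_sq]
  simp [covDerivJ]
  ring

lemma extDerivTwo_omega_eq (hn : IsLeviCivita H.metric nabla) (x y z : g) :
   
    extDerivTwo H.omega x y z
      = H.covDerivJ nabla x y z + H.covDerivJ nabla y z x + H.covDerivJ nabla z x y := by
  simp only [extDerivTwo, omega_apply, ← hn.torsion_free, map_sub, LinearMap.sub_apply, covDerivJ]
  have h1 := hn.metric x (H.J y) z
  have h2 := hn.metric y (H.J z) x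
  have h3 := hn.metric z (H.J x) y
  have h4 := H.inner.symm (H.J y) (nabla x z)
  have h5 := H.inner.symm (H.J z) (nabla y x)
  have h6 := H.inner.symm (H.J x) (nabla z y)
  have h7 := H.metric_J_left (nabla x z) y
  have h8 := H.metric_J_left (nabla y x) z
  have h9 := H.metric_J_left (nabla z y) x
  linarith

/-- Pair `N_J(y, z) = 0` with `x`, after writing every bracket through the torsion-free connection.
-/
lemma covDerivJ_integrable (hn : IsLeviCivita H.metric nabla) (x y z : g) :
   
    H.covDerivJ nabla (H.J y) z x + H.covDerivJ nabla y z (H.J x)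
      = H.covDerivJ nabla (H.J z) y x + H.covDerivJ nabla z y (H.J x) := by
  have h := congrArg (fun v => H.metric v x) (H.integrable y z)
  simp only [← hn.torsion_free, map_sub, map_add, LinearMap.sub_apply, LinearMap.add_apply,
    map_zero, LinearMap.zero_apply] at h
  have h1 := H.metric_J_left (nabla y (H.J z)) x
  have h2 := H.metric_J_left (nabla z (H.J y)) x
  have h3 := H.compat (nabla y z) x
  have h4 := H.compat (nabla z y) x
  unfold covDerivJ
  linarith

/-- Both values of `dω` are cyclic sums of `∇ω`. The `∇_x` terms add up, since `∇_x J` anticommutes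
with `J`; the remaining ones cancel by integrability at `(y, Jz)`. -/
lemma two_mul_covDerivJ (hn : IsLeviCivita H.metric nabla) (x y z : g) :
   
    2 * H.covDerivJ nabla x y z
      = extDerivTwo H.omega x y z - extDerivTwo H.omega x (H.J y) (H.J z) := by
  rw [extDerivTwo_omega_eq hn, extDerivTwo_omega_eq hn, covDerivJ_J_J]
  have h1 := covDerivJ_integrable hn x y (H.J z)
  have h2 := covDerivJ_J_J (H := H) (nabla := nabla) y z x
  have h3 := covDerivJ_J_left (H := H) (nabla := nabla) (H.J z) y x
  have h4 : H.covDerivJ nabla (H.J (H.J z)) y x = - H.covDerivJ nabla z y x := by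
    rw [H.J_sq]; simp [covDerivJ]; ring
  have h5 := covDerivJ_swap hn z x y
  have h6 := covDerivJ_swap hn (H.J z) x (H.J y)
  linarith

end

end HermitianLie

/-! ### Infinitesimal symmetries `A` and `JA` of a Vaisman structure -/

namespace UnitVaismanLie

variable {g : Type*} [LieRing g] [LieAlgebra ℝ g] (V : UnitVaismanLie g)

lemma theta_lie (x y : g) : V.theta ⁅x, y⁆ = 0 := by
  have := V.theta_closed x y
  unfold extDerivOne at this
  linarith

lemma metric_A_lie (x y : g) : V.metric V.A ⁅x, y⁆ = 0 := by
  rw [← V.dual, V.theta_lie]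

lemma theta_J (x : g) : V.theta (V.J x) = -V.metric (V.J V.A) x := by
  rw [V.dual, V.metric_J_left]; ring

/-- As `A` is parallel, zero torsion gives `ad A = ∇_A`, which is skew. -/
lemma metric_lie_A (x y : g) : V.metric ⁅V.A, x⁆ y = -V.metric x ⁅V.A, y⁆ := by
  obtain ⟨nabla, hn, hp⟩ := V.parallel
  have hA (u : g) : nabla u V.A = 0 := by
    refine V.eq_of_metric fun z => ?_
    have h1 := hn.metric u V.A z
    rw [← V.dual, hp] at h1
    simpa using h1
  have e (u : g) : ⁅V.A, u⁆ = nabla V.A u := by rw [← hn.torsion_free, hA, sub_zero]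
  have := hn.metric V.A x y
  rw [e, e]
  linarith

/-- Again `ad A = ∇_A`, and `∇_A J = 0`: in `two_mul_covDerivJ` the values of `θ ∧ ω` at `(A, x, z)`
and `(A, Jx, Jz)` agree. -/
lemma lie_A_J (x : g) : ⁅V.A, V.J x⁆ = V.J ⁅V.A, x⁆ := by
  obtain ⟨nabla, hn, hp⟩ := V.parallel
  have hA (u : g) : nabla u V.A = 0 := by
    refine V.eq_of_metric fun z => ?_
    have h1 := hn.metric u V.A z
    rw [← V.dual, hp] at h1
    simpa using h1
  have e (u : g) : ⁅V.A, u⁆ = nabla V.A u := by rw [← hn.torsion_free, hA, sub_zero]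
  refine V.eq_of_metric fun z => ?_
  have h := HermitianLie.two_mul_covDerivJ hn V.A x z
  rw [V.d_omega, V.d_omega] at h
  simp only [wedgeOneTwo, HermitianLie.omega_apply, V.J_sq, V.theta_J, map_neg,
    LinearMap.neg_apply] at h
  have h1 : V.metric (V.J x) V.A = - V.metric (V.J V.A) x := by
    rw [V.inner.symm, ← V.dual, V.theta_J]
  have h2 : V.metric (V.J z) V.A = - V.metric (V.J V.A) z := by
    rw [V.inner.symm, ← V.dual, V.theta_J]
  have h3 := V.metric_J_left x z
  have h4 := V.compat V.A x
  have h5 := V.compat V.A z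
  have h6 := V.inner.symm z V.A
  rw [← V.dual] at h4 h5 h6
  rw [h2, h4, h6, V.dual V.A, V.unit] at h
  unfold HermitianLie.covDerivJ at h
  rw [e, e]
  linarith

lemma lie_A_JA : ⁅V.A, V.J V.A⁆ = 0 := by rw [V.lie_A_J, lie_self, map_zero]

/-- Evaluate `dω = θ ∧ ω` at `(A, x, y)`: the two terms containing `ad A` cancel because `ad A`
preserves `ω`. -/
lemma metric_JA_lie (x y : g) : V.metric (V.J V.A) ⁅x, y⁆
    = V.metric (V.J x) y + V.metric (V.J V.A) x * V.theta y
      - V.theta x * V.metric (V.J V.A) y := by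
  have h := V.d_omega V.A x y
  simp only [extDerivTwo, wedgeOneTwo, HermitianLie.omega_apply] at h
  have h1 : V.metric (V.J y) V.A = - V.metric (V.J V.A) y := by
    rw [V.inner.symm, ← V.dual, V.theta_J]
  have h2 : V.metric (V.J ⁅x, y⁆) V.A = - V.metric (V.J V.A) ⁅x, y⁆ := by
    rw [V.inner.symm, ← V.dual, V.theta_J]
  have h3 : V.metric (V.J ⁅V.A, x⁆) y = -V.metric (V.J ⁅y, V.A⁆) x := by
    rw [← V.lie_A_J, V.metric_lie_A, V.metric_J_left ⁅y, V.A⁆, ← lie_skew V.A y,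
      V.inner.symm (V.J x), map_neg V.metric, LinearMap.neg_apply, neg_neg]
  have h4 : V.theta V.A = 1 := by rw [V.dual, V.unit]
  rw [h1, h2, h3, h4] at h
  linarith

lemma lie_JA_J (x : g) : ⁅V.J V.A, V.J x⁆ = V.J ⁅V.J V.A, x⁆ := by
  have h := V.integrable V.A x
  rw [V.lie_A_J, map_add, V.J_sq] at h
  rw [← sub_eq_zero, ← h]
  abel

/-- `dω = θ ∧ ω` at `(JA, u, y)` shows that `ad JA` preserves `ω` (this is `key`); commuting with
`J`, it then preserves the metric. -/
lemma metric_lie_JA (x y : g) : V.metric ⁅V.J V.A, x⁆ y = -V.metric x ⁅V.J V.A, y⁆ := by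
  have key (u : g) : V.metric (V.J ⁅V.J V.A, u⁆) y + V.metric (V.J u) ⁅V.J V.A, y⁆ = 0 := by
    have h := V.d_omega (V.J V.A) u y
    simp only [extDerivTwo, wedgeOneTwo, HermitianLie.omega_apply, V.compat, V.J_sq, V.theta_J,
      V.metric_JA_A, map_neg, LinearMap.neg_apply] at h
    have h1 := V.inner.symm ⁅u, y⁆ V.A
    have h2 := V.inner.symm y V.A
    have h3 := V.dual u
    have h4 := V.dual y
    have h5 := V.metric_J_left ⁅y, V.J V.A⁆ u
    have h6 := V.inner.symm (V.J u) ⁅V.J V.A, y⁆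
    have h7 := V.metric_A_lie u y
    simp only [← lie_skew y, map_neg, LinearMap.neg_apply] at h h5
    rw [h2, ← h3, ← h4] at h
    linarith
  have h := key (V.J x)
  simp only [V.lie_JA_J, V.J_sq, map_neg, LinearMap.neg_apply] at h
  linarith

end UnitVaismanLie

/-! ### Linear algebra of inner products -/

namespace IsInnerProductForm

variable {g : Type*} [AddCommGroup g] [Module ℝ g] {m : LinearMap.BilinForm ℝ g}

/-- The inner product space structure defined by an inner product form. -/
@[reducible]
def innerCore (hm : IsInnerProductForm m) : InnerProductSpace.Core ℝ g where
  inner x y := m x y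
  conj_inner_symm x y := hm.symm y x
  re_inner_nonneg x := by
    rcases eq_or_ne x 0 with rfl | hx
    · simp
    · exact (hm.pos x hx).le
  add_left x y z := by simp
  smul_left x y r := by simp
  definite x h := by
    by_contra hx
    exact (hm.pos x hx).ne' h

lemma exists_basis_trace_eq_sum (hm : IsInnerProductForm m) [FiniteDimensional ℝ g] :
    ∃ (n : ℕ) (b : Module.Basis (Fin n) ℝ g),
      ∀ f : g →ₗ[ℝ] g, LinearMap.trace ℝ g f = ∑ i, m (b i) (f (b i)) := by
  let : NormedAddCommGroup g := hm.innerCore.toNormedAddCommGroup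
  let : InnerProductSpace ℝ g := InnerProductSpace.ofCore hm.innerCore.toCore
  exact ⟨_, (stdOrthonormalBasis ℝ g).toBasis, fun f => by
    rw [LinearMap.trace_eq_sum_inner f (stdOrthonormalBasis ℝ g)]
    simp only [OrthonormalBasis.coe_toBasis]
    rfl⟩

/-- A nilpotent skew-symmetric endomorphism vanishes. -/
lemma eq_zero_of_isNilpotent (hm : IsInnerProductForm m) {f : Module.End ℝ g}
    (hf : ∀ x y, m (f x) y = -m x (f y)) (hnil : IsNilpotent f) : f = 0 := by
  obtain ⟨k, hk⟩ := hnil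
  induction k with
  | zero =>
    have h1 : (1 : Module.End ℝ g) = 0 := by simpa using hk
    rw [← mul_one f, h1, mul_zero]
  | succ k ih =>
    rcases k with _ | k
    · simpa using hk
    -- If `f^(k+2) = 0`, then `|f^(k+1) x|² = -⟨f^k x, f^(k+2) x⟩ = 0`.
    refine ih (LinearMap.ext fun x => ?_)
    by_contra hne
    have h := hm.pos _ hne
    have h2 : f ((f ^ (k + 1)) x) = 0 := by
      rw [← Module.End.mul_apply, ← pow_succ', hk, LinearMap.zero_apply]
    nth_rewrite 1 [pow_succ'] at h
    rw [Module.End.mul_apply, hf, h2] at h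
    simp at h

/-- Riesz representation. -/
lemma exists_forall_apply_eq (hm : IsInnerProductForm m) [FiniteDimensional ℝ g]
    (γ : Module.Dual ℝ g) : ∃ v, ∀ y, m v y = γ y := by
  have hinj : Function.Injective m := by
    rw [injective_iff_map_eq_zero]
    intro x hx
    by_contra hne
    have := hm.pos x hne
    rw [hx] at this
    exact this.false
  have hsurj := (LinearMap.injective_iff_surjective_of_finrank_eq_finrank
    (Subspace.dual_finrank_eq (K := ℝ) (V := g)).symm).1 hinj
  obtain ⟨v, hv⟩ := hsurj γ
  exact ⟨v, fun y => by rw [hv]⟩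

end IsInnerProductForm

/-! ### Trace identity and centrality of `JA` -/

namespace UnitVaismanLie

variable {g : Type*} [LieRing g] [LieAlgebra ℝ g] (V : UnitVaismanLie g)

/-- The orthogonal projection onto `W`, as an endomorphism of `g`. -/
def projEnd : g →ₗ[ℝ] g := V.W.subtype ∘ₗ V.projW

lemma projEnd_apply (x : g) :
    V.projEnd x = x - V.metric V.A x • V.A - V.metric (V.J V.A) x • V.J V.A := rfl

lemma metric_projEnd (x y : g) : V.metric (V.projEnd x) y
    = V.metric x y - V.theta x * V.theta y
      - V.metric (V.J V.A) x * V.metric (V.J V.A) y := by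
  simp [projEnd_apply, V.dual]

lemma metric_J_projEnd (x y : g) :
    V.metric (V.J (V.projEnd x)) y = V.metric (V.J V.A) ⁅x, y⁆ := by
  rw [V.metric_JA_lie]
  simp [projEnd_apply, V.dual, V.J_sq]
  ring

lemma projEnd_mem (x : g) : V.projEnd x ∈ V.W := (V.projW x).2

lemma projEnd_of_mem {x : g} (hx : x ∈ V.W) : V.projEnd x = x := by
  obtain ⟨h1, h2⟩ := V.mem_W.1 hx
  simp [projEnd_apply, h1, h2]

lemma projEnd_J (x : g) : V.projEnd (V.J x) = V.J (V.projEnd x) := by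
  have h1 := V.theta_J x
  rw [V.dual] at h1
  simp [projEnd_apply, h1, V.compat, V.J_sq]
  abel

/-- With `F = JP` and `T = ad v`, the hypothesis and the derivation property of `T` read `FT + TᵗF =
F`. Multiply by `F`, where `F² = -P`, and take traces: each term on the left contributes `tr T`. -/
lemma trace_ad_eq [FiniteDimensional ℝ g] {v : g}
    (hv : ∀ x y : g, V.metric (V.J V.A) ⁅v, ⁅x, y⁆⁆ = V.metric (V.J V.A) ⁅x, y⁆) :
    2 * LinearMap.trace ℝ g (LieAlgebra.ad ℝ g v) = LinearMap.trace ℝ g V.projEnd := by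
  obtain ⟨n, b, hb⟩ := V.inner.exists_basis_trace_eq_sum
  set F : g →ₗ[ℝ] g := V.J ∘ₗ V.projEnd with hF
  set T := LieAlgebra.ad ℝ g v with hT
  have hFm (x y : g) : V.metric (F x) y = V.metric (V.J V.A) ⁅x, y⁆ := V.metric_J_projEnd x y
  have hskew (x y : g) : V.metric (F x) y = -V.metric x (F y) := by
    rw [V.inner.symm x, hFm, hFm, ← lie_skew, map_neg]
  have hFF (x : g) : F (F x) = -V.projEnd x := by
    simp only [hF, LinearMap.comp_apply]
    rw [V.projEnd_J, V.J_sq, V.projEnd_of_mem (V.projEnd_mem x)]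
  have hFT (x y : g) :
      V.metric (F (T x)) y + V.metric (F x) (T y) = V.metric (F x) y := by
    rw [hFm, hFm, hFm, ← hv x y, leibniz_lie v x y, map_add]
    simp [hT]
  have hmain : -LinearMap.trace ℝ g (F ∘ₗ F ∘ₗ T) - LinearMap.trace ℝ g (F ∘ₗ T ∘ₗ F)
      = LinearMap.trace ℝ g V.projEnd := by
    rw [hb, hb, hb, ← Finset.sum_neg_distrib, ← Finset.sum_sub_distrib]
    refine Finset.sum_congr rfl fun i _ => ?_
    have h := hFT (b i) (F (b i))
    simp only [LinearMap.comp_apply]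
    have h1 := hskew (F (T (b i))) (b i)
    have h2 := hskew (b i) (T (F (b i)))
    have h3 := hskew (b i) (F (b i))
    have h4 := V.inner.symm (b i) (F (F (T (b i))))
    rw [hFF (b i), map_neg] at h3
    linarith
  have hcomm : LinearMap.trace ℝ g (F ∘ₗ T ∘ₗ F) = LinearMap.trace ℝ g (F ∘ₗ F ∘ₗ T) :=
    (LinearMap.trace_mul_comm ℝ F (T ∘ₗ F)).trans (LinearMap.trace_mul_comm ℝ T (F ∘ₗ F))
  -- `F²T = -PT`, and `P` only removes the `JA` component since the image of `T` is orthogonal to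
  -- `A`; by `hξ` the correction is traceless.
  have hFFT : F ∘ₗ F ∘ₗ T = -T + (V.metric (V.J V.A) ∘ₗ T).smulRight (V.J V.A) := by
    ext x
    have h : V.metric V.A (T x) = 0 := V.metric_A_lie v x
    change F (F (T x)) = _
    rw [hFF, projEnd_apply, h, LinearMap.add_apply,
      LinearMap.neg_apply, LinearMap.smulRight_apply, LinearMap.comp_apply]
    module
  have hξ : V.metric (V.J V.A) (T (V.J V.A)) = 0 := by
    rw [hT, LieAlgebra.ad_apply, V.metric_JA_lie, V.compat, V.metric_JA_JA, V.theta_J,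
      V.metric_JA_A, V.inner.symm, V.dual]
    ring
  have htr : LinearMap.trace ℝ g (F ∘ₗ F ∘ₗ T) = -LinearMap.trace ℝ g T := by
    rw [hFFT, map_add, map_neg, LinearMap.trace_smulRight, LinearMap.comp_apply, hξ, add_zero]
  rw [hcomm, htr] at hmain
  linarith

/-- The trace of an orthogonal projection is the sum of `|P b_i|²` over an orthonormal basis. -/
lemma projEnd_eq_zero_of_trace [FiniteDimensional ℝ g]
    (h : LinearMap.trace ℝ g V.projEnd = 0) : V.projEnd = 0 := by
  obtain ⟨n, b, hb⟩ := V.inner.exists_basis_trace_eq_sum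
  have hsq (x : g) : V.metric x (V.projEnd x) = V.metric (V.projEnd x) (V.projEnd x) := by
    obtain ⟨h1, h2⟩ := V.mem_W.1 (V.projEnd_mem x)
    rw [V.metric_projEnd, V.dual (V.projEnd x), h1, h2]
    ring
  have hnn (x : g) : 0 ≤ V.metric x x := by
    rcases eq_or_ne x 0 with rfl | hx
    · simp
    · exact (V.inner.pos x hx).le
  rw [hb] at h
  simp only [hsq] at h
  rw [Finset.sum_eq_zero_iff_of_nonneg fun i _ => hnn _] at h
  refine b.ext fun i => ?_
  by_contra hne
  exact (V.inner.pos _ hne).ne' (h i (Finset.mem_univ i))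

/-- On a solvable unimodular Lie algebra with a Vaisman structure, `JA` is central. -/
theorem lie_JA [FiniteDimensional ℝ g] (hsolv : LieAlgebra.IsSolvable g)
    (hunim : IsUnimodularLie g) (x : g) : ⁅V.J V.A, x⁆ = 0 := by
  by_cases hmem : V.J V.A ∈ LieAlgebra.derivedSeries ℝ g 1
  · have hnil : IsNilpotent (LieAlgebra.ad ℝ g (V.J V.A)) :=
      LieModule.isNilpotent_toEnd_of_mem_derivedSeries_one hmem
    have h0 := V.inner.eq_zero_of_isNilpotent (fun x y => V.metric_lie_JA x y) hnil
    rw [← LieAlgebra.ad_apply ℝ, h0, LinearMap.zero_apply]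
  · obtain ⟨f, hf, hker⟩ := Submodule.exists_le_ker_of_notMem
      (p := (LieAlgebra.derivedSeries ℝ g 1).toSubmodule) hmem
    have hflie (a b : g) : f ⁅a, b⁆ = 0 :=
      hker (LieSubmodule.lie_mem_lie (LieSubmodule.mem_top a) (LieSubmodule.mem_top b))
    -- The correction by `f` leaves `⟨JA, ·⟩` unchanged on `[g, g]` and makes it vanish at `JA`.
    obtain ⟨w, hw⟩ := V.inner.exists_forall_apply_eq
      (V.metric (V.J V.A) - (f (V.J V.A))⁻¹ • f)
    have hwξ : V.metric (V.J V.A) w = 0 := by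
      rw [V.inner.symm, hw]
      simp [V.metric_JA_JA, hf]
    -- Chosen so that `JPv = Pw`: for `c` in `[g, g]`, `⟨JA, [v, c]⟩ = ⟨Pw, c⟩ = ⟨w, c⟩ = ⟨JA, c⟩`.
    have htrace := V.trace_ad_eq (v := -V.J (V.projEnd w)) fun a b => by
      rw [← V.metric_J_projEnd, map_neg, V.projEnd_J, map_neg, V.J_sq, neg_neg,
        V.projEnd_of_mem (V.projEnd_mem w), V.metric_projEnd, hwξ, hw, V.theta_lie]
      simp [hflie]
    rw [hunim, mul_zero] at htrace
    have hP := LinearMap.congr_fun (V.projEnd_eq_zero_of_trace htrace.symm) x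
    rw [projEnd_apply, LinearMap.zero_apply, sub_sub, sub_eq_zero] at hP
    rw [hP, lie_add, lie_smul, lie_smul, lie_self, ← lie_skew, V.lie_A_JA]
    simp

end UnitVaismanLie

/-! ### Reduction by the central line `ℝ JA` -/

namespace UnitVaismanLie

variable {g : Type*} [LieRing g] [LieAlgebra ℝ g] {V : UnitVaismanLie g}

lemma projW_lie_coe (x y : g) :
    (V.projW ⁅x, y⁆ : g) = ⁅x, y⁆ - V.metric (V.J V.A) ⁅x, y⁆ • V.J V.A := by
  rw [projW_coe, metric_A_lie, zero_smul, sub_zero]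

/-- On commutators the projection subtracts a multiple of the central `JA`, so inside an outer
bracket it can be dropped. -/
lemma jacobiW_of_lie_JA (hc : ∀ x : g, ⁅V.J V.A, x⁆ = 0) : V.JacobiW := by
  have hc' (x : g) : ⁅x, V.J V.A⁆ = 0 := by rw [← lie_skew, hc, neg_zero]
  intro x y z
  have e1 (u : g) : ⁅u, (V.bracketW y z : g)⁆ = ⁅u, ⁅(y : g), (z : g)⁆⁆ := by
    rw [bracketW, projW_lie_coe, lie_sub, lie_smul, hc', smul_zero, sub_zero]
  have e2 (u : g) : ⁅u, (V.bracketW x z : g)⁆ = ⁅u, ⁅(x : g), (z : g)⁆⁆ := by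
    rw [bracketW, projW_lie_coe, lie_sub, lie_smul, hc', smul_zero, sub_zero]
  have e3 (u : g) : ⁅(V.bracketW x y : g), u⁆ = ⁅⁅(x : g), (y : g)⁆, u⁆ := by
    rw [bracketW, projW_lie_coe, sub_lie, smul_lie, hc, smul_zero, sub_zero]
  change V.projW _ = V.projW _ + V.projW _
  rw [e1, e2, e3, leibniz_lie, map_add]

lemma lie_A_mem_W {x : g} (hx : x ∈ V.W) : ⁅V.A, x⁆ ∈ V.W := by
  obtain ⟨h1, h2⟩ := V.mem_W.1 hx
  refine V.mem_W.2 ⟨V.metric_A_lie _ _, ?_⟩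
  rw [metric_JA_lie, h2, V.metric_JA_A, V.dual V.A, V.unit]
  ring

variable {hk : V.JacobiW}

lemma inclK_injective : Function.Injective (inclK hk) := Subtype.val_injective

lemma inclK_mem (x : V.K hk) : inclK hk x ∈ V.W := x.2

lemma metric_A_inclK (x : V.K hk) : V.metric V.A (inclK hk x) = 0 := (V.mem_W.1 (inclK_mem x)).1

lemma metric_JA_inclK (x : V.K hk) : V.metric (V.J V.A) (inclK hk x) = 0 :=
  (V.mem_W.1 (inclK_mem x)).2

lemma metric_inclK_A (x : V.K hk) : V.metric (inclK hk x) V.A = 0 := by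
  rw [V.inner.symm, metric_A_inclK]

lemma inclK_lie_eq (x y : V.K hk) : inclK hk ⁅x, y⁆ = ⁅inclK hk x, inclK hk y⁆
    - V.metric (V.J V.A) ⁅inclK hk x, inclK hk y⁆ • V.J V.A := by
  rw [inclK_lie, projW_lie_coe]

/-- The restriction of `ad A` to `k`. -/
def adK (hk : V.JacobiW) : V.K hk →ₗ[ℝ] V.K hk :=
  (LieAlgebra.ad ℝ g V.A).restrict (p := V.W) (q := V.W) fun _ hx => lie_A_mem_W hx

lemma inclK_adK (x : V.K hk) : inclK hk (adK hk x) = ⁅V.A, inclK hk x⁆ := rfl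

/-- The restriction of `ad A` to `k`, as a derivation of `k`. -/
def adA (hk : V.JacobiW) (hc : ∀ x : g, ⁅V.J V.A, x⁆ = 0) :
    LieDerivation ℝ (V.K hk) (V.K hk) where
  toLinearMap := adK hk
  leibniz' x y := by
    have hc' (x : g) : ⁅x, V.J V.A⁆ = 0 := by rw [← lie_skew, hc, neg_zero]
    apply inclK_injective (hk := hk)
    -- By centrality `[A, [x, y]] = [A, P[x, y]]`, and `ad A` preserves `W`.
    have h0 : V.metric (V.J V.A) ⁅V.A, ⁅inclK hk x, inclK hk y⁆⁆ = 0 := by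
      have h := metric_JA_inclK (adK hk ⁅x, y⁆)
      rwa [inclK_adK, inclK_lie_eq, lie_sub, lie_smul, hc', smul_zero, sub_zero] at h
    rw [map_sub, inclK_lie_eq, inclK_lie_eq, inclK_adK, inclK_adK, inclK_adK, inclK_lie_eq,
      lie_sub, lie_smul, hc', smul_zero, sub_zero]
    rw [leibniz_lie, map_add] at h0
    have e : ⁅inclK hk y, ⁅V.A, inclK hk x⁆⁆ = -⁅⁅V.A, inclK hk x⁆, inclK hk y⁆ :=
      (lie_skew _ _).symm
    rw [leibniz_lie, e, map_neg, eq_neg_of_add_eq_zero_left h0]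
    module

lemma inclK_adA (hc : ∀ x : g, ⁅V.J V.A, x⁆ = 0) (x : V.K hk) :
    inclK hk (adA hk hc x) = ⁅V.A, inclK hk x⁆ := rfl

section

variable (D : LieDerivation ℝ (V.K hk) (V.K hk))

lemma inclD_apply (u : RealSemidirect D) :
    inclD D u = u.right • V.A + inclK hk u.left := rfl

lemma metric_A_inclD (u : RealSemidirect D) : V.metric V.A (inclD D u) = u.right := by
  simp [inclD_apply, V.unit, metric_A_inclK]

lemma metric_JA_inclD (u : RealSemidirect D) : V.metric (V.J V.A) (inclD D u) = 0 := by
  simp [inclD_apply, V.metric_JA_A, metric_JA_inclK]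

lemma inclD_injective : Function.Injective (inclD D) := by
  intro u v h
  have hr : u.right = v.right := by rw [← metric_A_inclD, ← metric_A_inclD, h]
  refine LieAlgebra.SemiDirectSum.ext (inclK_injective ?_) hr
  rw [inclD_apply, inclD_apply, hr] at h
  exact add_left_cancel h

lemma etaD_apply (u : RealSemidirect D) : etaD D u = u.right := by
  rw [← metric_A_inclD, ← V.dual]; rfl

lemma inclD_xiD : inclD D (xiD D) = V.A := by simp [inclD_apply, xiD]

lemma inclD_phiD (u : RealSemidirect D) : inclD D (phiD D u) = V.J (inclK hk u.left) := by
  simp [inclD_apply, phiD]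

lemma inclD_phiD_eq (u : RealSemidirect D) :
    inclD D (phiD D u) = V.J (inclD D u) - u.right • V.J V.A := by
  rw [inclD_phiD, inclD_apply]; simp

lemma metricD_apply (u v : RealSemidirect D) :
    metricD D u v = V.metric (inclD D u) (inclD D v) := rfl

/-- Identifies `Φ` with the `JA` coefficient lost in projecting the bracket of `g` to `d`. -/
lemma PhiD_apply (u v : RealSemidirect D) :
    PhiD D u v = V.metric (V.J V.A) ⁅inclD D u, inclD D v⁆ := by
  change V.metric (inclD D (phiD D u)) (inclD D v) = _
  rw [inclD_phiD_eq, metric_JA_lie, metric_JA_inclD, metric_JA_inclD]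
  simp [metric_JA_inclD]

lemma isAlmostContactMetric : IsAlmostContactMetric (metricD D) (phiD D) (xiD D) (etaD D) where
  inner :=
    { symm := fun u v => V.inner.symm _ _
      pos := fun u hu => V.inner.pos _ fun h => hu (inclD_injective D (h.trans (map_zero _).symm)) }
  eta_xi := etaD_apply D _
  phi_sq u := by
    apply inclD_injective D
    rw [map_add, map_neg, map_smul, inclD_phiD, inclD_xiD, etaD_apply, inclD_apply]
    change V.J (inclK hk (JK hk u.left)) = _
    rw [inclK_JK, V.J_sq]
    abel
  compat u v := by
    rw [metricD_apply, metricD_apply, inclD_phiD, inclD_phiD, V.compat, etaD_apply, etaD_apply,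
      inclD_apply, inclD_apply]
    simp [V.unit, metric_A_inclK, metric_inclK_A]

variable {D}

lemma inclD_lie (hD : ∀ x, inclK hk (D x) = ⁅V.A, inclK hk x⁆)
    (u v : RealSemidirect D) : inclD D ⁅u, v⁆ = ⁅inclD D u, inclD D v⁆
    - V.metric (V.J V.A) ⁅inclD D u, inclD D v⁆ • V.J V.A := by
  obtain ⟨x, a⟩ := u
  obtain ⟨y, b⟩ := v
  rw [RealSemidirect.lie_eq, ← PhiD_apply]
  have hP : PhiD D ⟨x, a⟩ ⟨y, b⟩ = V.metric (V.J V.A) ⁅inclK hk x, inclK hk y⁆ := by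
    change V.metric (inclD D (phiD D _)) _ = _
    rw [inclD_phiD, metric_JA_lie, metric_JA_inclK, metric_JA_inclK, inclD_apply]
    have : V.metric (V.J (inclK hk x)) V.A = 0 := by
      rw [← inclK_JK, metric_inclK_A]
    simp [this]
  rw [hP]
  simp only [inclD_apply, map_add, map_sub, map_smul, inclK_lie_eq, hD, zero_smul, zero_add,
    add_lie, lie_add, smul_lie, lie_smul, lie_self, smul_zero]
  rw [← lie_skew (inclK hk x) V.A]
  module

lemma isCoKahler (hD : ∀ x, inclK hk (D x) = ⁅V.A, inclK hk x⁆)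
    (hc : ∀ x : g, ⁅V.J V.A, x⁆ = 0) :
    IsCoKahler (metricD D) (phiD D) (xiD D) (etaD D) where
  toIsAlmostContactMetric := isAlmostContactMetric D
  eta_closed u v := by
    rw [extDerivOne, etaD_apply, RealSemidirect.lie_eq, neg_zero]
  Phi_closed u v w := by
    -- Centrality turns each term of `dΦ` into the `JA` coefficient of a double bracket in `g`, so
    -- Jacobi applies.
    have key (a b c : RealSemidirect D) : fundamentalForm (metricD D) (phiD D) ⁅a, b⁆ c
        = V.metric (V.J V.A) ⁅⁅inclD D a, inclD D b⁆, inclD D c⁆ := by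
      refine (PhiD_apply D _ _).trans ?_
      rw [inclD_lie hD, sub_lie, smul_lie, hc, smul_zero, sub_zero]
    rw [extDerivTwo, key, key, key]
    have h := congrArg (V.metric (V.J V.A)) (lie_jacobi (inclD D u) (inclD D v) (inclD D w))
    rw [map_add, map_add, map_zero, ← lie_skew (inclD D u) ⁅inclD D v, _⁆, ← lie_skew (inclD D v) ⁅inclD D w, _⁆,
      ← lie_skew (inclD D w) ⁅inclD D u, _⁆, map_neg, map_neg, map_neg] at h
    linarith
  normal u v := by
    have hη : extDerivOne (etaD D) u v = 0 := by
      rw [extDerivOne, etaD_apply, RealSemidirect.lie_eq, neg_zero]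
    rw [hη, zero_smul, neg_zero]
    obtain ⟨x, a⟩ := u
    obtain ⟨y, b⟩ := v
    apply inclD_injective D
    -- `D` commutes with `J`, which cancels the terms of `N_φ` involving `A`; what remains is `N_J`
    -- projected to `k`.
    have hJD (z : V.K hk) : JK hk (D (JK hk z)) = -D z := by
      apply inclK_injective
      rw [map_neg, inclK_JK, hD, hD, inclK_JK, V.lie_A_J, V.J_sq]
    have hJJ (z : V.K hk) : JK hk (JK hk z) = -z := by
      apply inclK_injective
      rw [map_neg, inclK_JK, inclK_JK, V.J_sq]
    have hphi (z : V.K hk) (c : ℝ) :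
        phiD D ⟨z, c⟩ = (⟨JK hk z, 0⟩ : RealSemidirect D) := rfl
    have hN : ⁅JK hk x, JK hk y⁆ - ⁅x, y⁆ - JK hk (⁅JK hk x, y⁆ + ⁅x, JK hk y⁆) = 0 := by
      have hPJ (z : g) : (V.projW (V.J z) : g) = V.J (V.projW z) := V.projEnd_J z
      apply inclK_injective
      have h := congrArg (fun z => (V.projW z : g)) (V.integrable (inclK hk x) (inclK hk y))
      simp only [map_sub, map_add, Submodule.coe_sub, Submodule.coe_add, hPJ] at h
      simpa only [map_sub, map_add, inclK_lie, inclK_JK, map_zero, Submodule.coe_zero] using h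
    congr 1
    rw [nijenhuis]
    simp only [hphi, RealSemidirect.lie_eq, LieAlgebra.SemiDirectSum.add_eq_mk,
      LieAlgebra.SemiDirectSum.sub_eq_mk, LieAlgebra.SemiDirectSum.zero_eq_mk]
    congr 1
    · rw [← hN]
      simp only [map_add, map_sub, map_smul, hJD, hJJ]
      module
    · simp

/-- The isomorphism from the central extension `d_Φ(JA)` to `g`. -/
def centralExtensionEquiv (hD : ∀ x, inclK hk (D x) = ⁅V.A, inclK hk x⁆)
    (hc : ∀ x : g, ⁅V.J V.A, x⁆ = 0) (halt : (PhiD D).IsAlt)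
    (hclosed : ∀ x y z, extDerivTwo (PhiD D) x y z = 0) :
    CentralExtension (PhiD D) halt hclosed ≃ₗ⁅ℝ⁆ g where
  toFun z := inclD D z.carrier.1 + TrivialLieModule.equiv ℝ _ ℝ z.carrier.2 • V.J V.A
  map_add' z w := by
    change inclD D (z.carrier.1 + w.carrier.1)
      + TrivialLieModule.equiv ℝ _ ℝ (z.carrier.2 + w.carrier.2) • V.J V.A = _
    rw [map_add, map_add, add_smul]
    abel
  map_smul' t z := by
    change inclD D (t • z.carrier.1)
      + TrivialLieModule.equiv ℝ _ ℝ (t • z.carrier.2) • V.J V.A = _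
    rw [map_smul, map_smul, smul_assoc, ← smul_add]
    rfl
  map_lie' {z w} := by
    have hc' (x : g) : ⁅x, V.J V.A⁆ = 0 := by rw [← lie_skew, hc, neg_zero]
    obtain ⟨⟨u, s⟩⟩ := z
    obtain ⟨⟨v, t⟩⟩ := w
    have h := CentralExtension.mk_lie_mk (halt := halt) (hclosed := hclosed) u v
      (TrivialLieModule.equiv ℝ _ ℝ s) (TrivialLieModule.equiv ℝ _ ℝ t)
    refine (congrArg (fun c : CentralExtension (PhiD D) halt hclosed => inclD D c.carrier.1
      + TrivialLieModule.equiv ℝ _ ℝ c.carrier.2 • V.J V.A) h).trans ?_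
    change inclD D ⁅u, v⁆ + PhiD D u v • V.J V.A = _
    simp only [inclD_lie hD, PhiD_apply, add_lie, lie_add, smul_lie, lie_smul, hc, hc']
    simp
  invFun x := CentralExtension.mk ⟨V.projW x, V.metric V.A x⟩ (V.metric (V.J V.A) x)
  left_inv z := by
    obtain ⟨⟨⟨y, a⟩, t⟩⟩ := z
    have h1 (r : ℝ) : V.metric V.A (inclD D ⟨y, a⟩ + r • V.J V.A) = a := by
      rw [map_add, map_smul, V.metric_A_JA, metric_A_inclD, smul_zero, add_zero]
    have h2 (r : ℝ) : V.metric (V.J V.A) (inclD D ⟨y, a⟩ + r • V.J V.A) = r := by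
      rw [map_add, map_smul, V.metric_JA_JA, metric_JA_inclD, smul_eq_mul, mul_one, zero_add]
    have h3 (r : ℝ) : V.projW (inclD D ⟨y, a⟩ + r • V.J V.A) = y := by
      refine Subtype.ext ?_
      rw [projW_coe, h1, h2, inclD_apply]
      change a • V.A + V.W.subtype y + r • V.J V.A - a • V.A - r • V.J V.A = V.W.subtype y
      abel
    simp only [h1, h2, h3]
    rfl
  right_inv x := by
    change V.metric V.A x • V.A + (V.projW x : g) + V.metric (V.J V.A) x • V.J V.A = x
    rw [projW_coe]
    abel

end

end UnitVaismanLie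

theorem mainTheorem5 {g : Type*} [LieRing g] [LieAlgebra ℝ g] [FiniteDimensional ℝ g]
    (hsolv : LieAlgebra.IsSolvable g) (hunim : IsUnimodularLie g) (V : UnitVaismanLie g) :
    ∃ (hk : V.JacobiW) (D' : LieDerivation ℝ (V.K hk) (V.K hk)),
      (∀ x : V.K hk, UnitVaismanLie.inclK hk (D' x) = ⁅V.A, UnitVaismanLie.inclK hk x⁆) ∧
      ∃ hco : IsCoKahler (UnitVaismanLie.metricD D') (UnitVaismanLie.phiD D')
          (UnitVaismanLie.xiD D') (UnitVaismanLie.etaD D'),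
        ∃ e : CentralExtension (UnitVaismanLie.PhiD D') hco.isAlt hco.Phi_closed ≃ₗ⁅ℝ⁆ g,
          ∀ (u : RealSemidirect D') (t : ℝ),
            e (CentralExtension.mk u t) = UnitVaismanLie.inclD D' u + t • V.J V.A := by
  have hc := V.lie_JA hsolv hunim
  have hk := UnitVaismanLie.jacobiW_of_lie_JA hc
  have hD := UnitVaismanLie.inclK_adA (hk := hk) hc
  have hco := UnitVaismanLie.isCoKahler hD hc
  exact ⟨hk, UnitVaismanLie.adA hk hc, hD, hco,
    UnitVaismanLie.centralExtensionEquiv hD hc hco.isAlt hco.Phi_closed, fun u t => rfl⟩
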